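/- Let $n\ge 0$, let $\Bbbk$ be a field whose characteristic does not divide $2(n+1)$, let $R=\Bbbk[x_1,\dots,x_{n+1}]/(x_1+\dots+x_{n+1})$ and $f_i=x_i-x_{i+1}$ for $1\le i\le n$, so that $R=\Bbbk[f_1,\dots,f_n]$. Call indices $i,j\in\{1,\dots,n\}$ adjacent if $|i-j|=1$ and distant if $|i-j|\ge 2$. Let $\mathcal{TLC}_1$ be the following $\Bbbk$-linear strict monoidal category. Its objects are the finite sequences of indices, with concatenation as tensor product. A morphism from $\underline j$ to $\underline i$ is a $\Bbbk$-linear combination of families $(\Gamma_i)_{1\le i\le n}$ of graphs in the strip $\mathbb R\times[0,1]$ ($\Gamma_i$ is said to have colour $i$), each $\Gamma_i$ embedded and having only univalent vertices ("dots") and trivalent vertices and edges that may run to the boundary, with $\Gamma_i\cap\Gamma_{i+1}=\emptyset$ (graphs of distant colours may cross in the interior), with bottom boundary $\underline j$ and top boundary $\underline i$. These are taken modulo isotopy of each $\Gamma_i$ separately (keeping $\Gamma_i$ and $\Gamma_{i+1}$ disjoint) and modulo the following local relations: (a) the two trivalent trees of one colour with four boundary edges are equal; (b) a trivalent vertex with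 a dot on one of its edges is a line; (c) a trivalent vertex two of whose edges are joined to each other around an empty region is $0$; (d) writing $f_j$ for a "double dot" (an edge of colour $j$ ending in two dots) placed in a region, $|_i$ for a vertical line of colour $i$ and $b_i$ for this line broken into two dots, $f_i\,|_i + |_i\,f_i = 2\,b_i$, and $f_j\,|_i = |_i\,f_j + |_i\,f_i - b_i$ for $i,j$ adjacent; (e) for $i,j$ adjacent, in a disc with boundary $i,j,i,j$ in cyclic order, the picture in which the two $i$'s are joined by an edge and the two $j$'s end in dots, plus the picture in which the two $j$'s are joined by an edge and the two $i$'s end in dots, is $0$. Composition is vertical and tensor product is horizontal concatenation. Let $R$ act on ${\rm HOM}(\emptyset,\underline i)$ by placing double dots at the left of a picture, $f_i$ being the double dot of colour $i$, and let $\phi_{\underline i}\in{\rm HOM}(\emptyset,\underline i)$ be the picture consisting of one dot joined to the boundary for every entry of $\underline i$. The TL ideal $I_{\underline i}\subset R$ is the kernel of the map $R\to{\rm HOM}(\emptyset,\underline i)$, $r\mapsto r\,\phi_{\underline i}$. For $1\le i<j\le n$ put $$y_{i,j}=f_if_j\,(f_i+2f_{i+1}+2f_{i+2}+\dots+2f_{j-1}+f_j).$$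 **Proposition.** The TL ideal $I_\emptyset$ contains $y_{i,j}$ for all $1\le i<j\le n$. For every sequence $\underline i$ without repeated entries, the TL ideal $I_{\underline i}$ contains $$z_{i,j,\underline i}=\frac{y_{i,j}}{g_ig_j}\qquad\text{for all } 1\le i<j\le n,$$ where $g_k=f_k$ if $k$ occurs in $\underline i$ and $g_k=1$ otherwise. -/

import Mathlib

open CategoryTheory MonoidalCategory

universe u

namespace TLC

/-! ## The polynomial ring `R = 𝕜[x₁, …, xₙ₊₁] / (e₁)` -/

section Polynomials

variable (𝕜 : Type u) [Field 𝕜] (n : ℕ)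

/-- `R = 𝕜[x₁, …, xₙ₊₁] / (x₁ + ⋯ + xₙ₊₁)`.  The variables are indexed by `Fin (n + 1)` and the
vertices of the Dynkin diagram `Aₙ` by `Fin n`. -/
abbrev R : Type u :=
  MvPolynomial (Fin (n + 1)) 𝕜 ⧸
    Ideal.span {∑ m : Fin (n + 1), (MvPolynomial.X m : MvPolynomial (Fin (n + 1)) 𝕜)}

/-- The class of the variable `x_m` in `R`. -/
noncomputable def x (m : Fin (n + 1)) : R 𝕜 n := Ideal.Quotient.mk _ (MvPolynomial.X m)

/-- `f_i = x_i - x_{i+1}`. -/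
noncomputable def f (i : Fin n) : R 𝕜 n := x 𝕜 n i.castSucc - x 𝕜 n i.succ

/-- `y_{i,j} = f_i f_j (f_i + 2 f_{i+1} + ⋯ + 2 f_{j-1} + f_j)`, used for `i < j`. -/
noncomputable def y (i j : Fin n) : R 𝕜 n :=
  f 𝕜 n i * f 𝕜 n j * (f 𝕜 n i + ∑ l ∈ Finset.Ioo i j, 2 * f 𝕜 n l + f 𝕜 n j)

/-- `g_i = f_i` if `i` occurs in the sequence `s`, and `g_i = 1` otherwise. -/
noncomputable def g (s : List (Fin n)) (i : Fin n) : R 𝕜 n := if i ∈ s then f 𝕜 n i else 1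

/-- `z_{i,j,s} = y_{i,j} / (g_i g_j)`, used for `i < j`; see `z_mul`. -/
noncomputable def z (s : List (Fin n)) (i j : Fin n) : R 𝕜 n :=
  (if i ∈ s then 1 else f 𝕜 n i) * (if j ∈ s then 1 else f 𝕜 n j) *
    (f 𝕜 n i + ∑ l ∈ Finset.Ioo i j, 2 * f 𝕜 n l + f 𝕜 n j)

theorem z_mul (s : List (Fin n)) (i j : Fin n) :
    z 𝕜 n s i j * (g 𝕜 n s i * g 𝕜 n s j) = y 𝕜 n i j := by
  unfold z g y
  split_ifs <;> ring

/-- `x_m` as a linear form in the `f_l`: `x₁ = (n f₁ + (n-1) f₂ + ⋯ + fₙ) / (n + 1)` and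
`x_m = x₁ - f₁ - ⋯ - f_{m-1}`. -/
noncomputable def xForm (m : Fin (n + 1)) : MvPolynomial (Fin n) 𝕜 :=
  MvPolynomial.C ((n + 1 : 𝕜)⁻¹) *
      ∑ l : Fin n, MvPolynomial.C ((n : 𝕜) - ((l : ℕ) : 𝕜)) * MvPolynomial.X l -
    ∑ l : Fin n, if l.castSucc < m then MvPolynomial.X l else 0

variable {𝕜 n}

theorem sum_xForm (hchar : ¬ ringChar 𝕜 ∣ 2 * (n + 1)) :
    ∑ m : Fin (n + 1), xForm 𝕜 n m = 0 := by
  have hn : (n + 1 : 𝕜) ≠ 0 := by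
    intro h
    apply hchar
    apply Dvd.dvd.mul_left
    rw [← ringChar.spec]
    exact_mod_cast h
  have hcard (l : Fin n) :
      (∑ m : Fin (n + 1), if l.castSucc < m then (MvPolynomial.X l : MvPolynomial (Fin n) 𝕜) else 0)
        = MvPolynomial.C ((n : 𝕜) - ((l : ℕ) : 𝕜)) * MvPolynomial.X l := by
    rw [← Finset.sum_filter, Finset.sum_const]
    have : (Finset.univ.filter fun m => l.castSucc < m) = Finset.Ioi l.castSucc := by
      ext; simp
    rw [this, Fin.card_Ioi, nsmul_eq_mul]
    have h2 : n + 1 - 1 - (l.castSucc : ℕ) = n - l := by simp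
    rw [h2, Nat.cast_sub l.isLt.le]
    simp
  unfold xForm
  rw [Finset.sum_sub_distrib, Finset.sum_comm]
  simp only [hcard, Finset.sum_const, Finset.card_univ, Fintype.card_fin, nsmul_eq_mul]
  have hC : ((n + 1 : ℕ) : MvPolynomial (Fin n) 𝕜) = MvPolynomial.C (n + 1 : 𝕜) := by simp
  rw [hC, ← mul_assoc, ← MvPolynomial.C_mul, mul_inv_cancel₀ hn, MvPolynomial.C_1, one_mul,
    sub_self]

/-- The identification `R = 𝕜[f₁, …, fₙ]`, as a map from `R` to the polynomial ring. -/
noncomputable def toF (hchar : ¬ ringChar 𝕜 ∣ 2 * (n + 1)) : R 𝕜 n →ₐ[𝕜] MvPolynomial (Fin n) 𝕜 :=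
  Ideal.Quotient.liftₐ _ (MvPolynomial.aeval (xForm 𝕜 n)) (by
    intro a ha
    have hle : Ideal.span {∑ m : Fin (n + 1), (MvPolynomial.X m : MvPolynomial (Fin (n + 1)) 𝕜)}
        ≤ RingHom.ker (MvPolynomial.aeval (R := 𝕜) (xForm 𝕜 n)) := by
      rw [Ideal.span_singleton_le_iff_mem, RingHom.mem_ker, map_sum]
      simpa using sum_xForm hchar
    exact hle ha)

theorem toF_f (hchar : ¬ ringChar 𝕜 ∣ 2 * (n + 1)) (i : Fin n) :
    toF hchar (f 𝕜 n i) = MvPolynomial.X i := by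
  have hx (m : Fin (n + 1)) : toF hchar (x 𝕜 n m) = xForm 𝕜 n m := by
    refine (Ideal.Quotient.lift_mk _ _ _).trans ?_
    exact MvPolynomial.aeval_X _ _
  rw [f, map_sub, hx, hx]
  unfold xForm
  rw [sub_sub_sub_cancel_left, ← Finset.sum_sub_distrib, Finset.sum_eq_single i]
  · simp
  · intro l _ hl
    have : l.castSucc < i.succ ↔ l.castSucc < i.castSucc := by
      simp only [Fin.lt_def, Fin.val_succ, Fin.val_castSucc]
      have : (l : ℕ) ≠ i := fun h => hl (Fin.ext h)
      omega
    simp [this]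
  · simp

end Polynomials

/-! ## The category `TLC₁`

It is the `𝕜`-linear strict monoidal category whose objects are the finite sequences of indices and
whose morphisms are generated by coloured planar pictures, read from bottom to top, modulo planar
isotopy, the sliding of distant colours past each other, and the local relations. -/

/-- Adjacent vertices of the Dynkin diagram. -/
def Adjacent {n : ℕ} (i j : Fin n) : Prop := (i : ℕ) + 1 = j ∨ (j : ℕ) + 1 = i

/-- Distant indices, `|i - j| ≥ 2`. -/
def Distant {n : ℕ} (i j : Fin n) : Prop := (i : ℕ) + 2 ≤ j ∨ (j : ℕ) + 2 ≤ i

theorem Distant.symm {n : ℕ} {i j : Fin n} (h : Distant i j) : Distant j i := Or.symm h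

/-- Formal `𝕜`-linear combinations of pictures with bottom boundary `a` and top boundary `b`. -/
inductive Diagram (𝕜 : Type u) (n : ℕ) : List (Fin n) → List (Fin n) → Type u
  /-- The identity picture (vertical lines); `a` and `b` are the same sequence, possibly written
  differently, such as `(c ++ d) ++ e` and `c ++ (d ++ e)`. -/
  | ofEq {a b : List (Fin n)} (h : a = b) : Diagram 𝕜 n a b
  /-- Vertical concatenation, first argument at the bottom. -/
  | comp {a b c : List (Fin n)} : Diagram 𝕜 n a b → Diagram 𝕜 n b c → Diagram 𝕜 n a c
  /-- Horizontal concatenation. -/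
  | tens {a b c d : List (Fin n)} :
      Diagram 𝕜 n a b → Diagram 𝕜 n c d → Diagram 𝕜 n (a ++ c) (b ++ d)
  | zero {a b : List (Fin n)} : Diagram 𝕜 n a b
  | add {a b : List (Fin n)} : Diagram 𝕜 n a b → Diagram 𝕜 n a b → Diagram 𝕜 n a b
  | smul {a b : List (Fin n)} : 𝕜 → Diagram 𝕜 n a b → Diagram 𝕜 n a b
  /-- A dot with its edge going up to the top boundary. -/
  | startdot (i : Fin n) : Diagram 𝕜 n [] [i]
  /-- A dot with its edge going down to the bottom boundary. -/
  | enddot (i : Fin n) : Diagram 𝕜 n [i] []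
  /-- A trivalent vertex with two edges down and one up. -/
  | merge (i : Fin n) : Diagram 𝕜 n [i, i] [i]
  /-- A trivalent vertex with one edge down and two up. -/
  | split (i : Fin n) : Diagram 𝕜 n [i] [i, i]
  /-- An edge with both ends on the top boundary. -/
  | cup (i : Fin n) : Diagram 𝕜 n [] [i, i]
  /-- An edge with both ends on the bottom boundary. -/
  | cap (i : Fin n) : Diagram 𝕜 n [i, i] []
  /-- The crossing (4-valent vertex) of two edges of distant colours. -/
  | cross (i j : Fin n) (h : Distant i j) : Diagram 𝕜 n [i, j] [j, i]

namespace Diagram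

local infixr:70 " ⊚ " => Diagram.comp
local infixr:75 " ⊠ " => Diagram.tens
local infixl:65 " +ᵈ " => Diagram.add

variable {𝕜 : Type u} [Field 𝕜] {n : ℕ}

/-- The identity picture. -/
abbrev id (a : List (Fin n)) : Diagram 𝕜 n a a := ofEq rfl

/-- The double dot of colour `i`. -/
abbrev ddot (i : Fin n) : Diagram 𝕜 n [] [] := startdot i ⊚ enddot i

/-- The broken line of colour `i`. -/
abbrev broken (i : Fin n) : Diagram 𝕜 n [i] [i] := enddot i ⊚ startdot i

/-- The generating relations between pictures. -/
inductive LocalRel : {a b : List (Fin n)} → Diagram 𝕜 n a b → Diagram 𝕜 n a b → Prop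
  -- planar isotopy of one colour: edges may be straightened, vertices may be rotated
  | zigzag_left (i : Fin n) :
      LocalRel ((cup i ⊠ id [i]) ⊚ (id [i] ⊠ cap i) : Diagram 𝕜 n [i] [i]) (id [i])
  | zigzag_right (i : Fin n) :
      LocalRel ((id [i] ⊠ cup i) ⊚ (cap i ⊠ id [i]) : Diagram 𝕜 n [i] [i]) (id [i])
  | rotate_dot_left (i : Fin n) :
      LocalRel ((startdot i ⊠ id [i]) ⊚ cap i : Diagram 𝕜 n [i] []) (enddot i)
  | rotate_dot_right (i : Fin n) :
      LocalRel ((id [i] ⊠ startdot i) ⊚ cap i : Diagram 𝕜 n [i] []) (enddot i)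
  | rotate_merge_left (i : Fin n) :
      LocalRel ((cup i ⊠ id [i]) ⊚ (id [i] ⊠ merge i) : Diagram 𝕜 n [i] [i, i]) (split i)
  | rotate_merge_right (i : Fin n) :
      LocalRel ((id [i] ⊠ cup i) ⊚ (merge i ⊠ id [i]) : Diagram 𝕜 n [i] [i, i]) (split i)
  -- isotopy of distant colours with respect to each other
  | rotate_cross_left (i j : Fin n) (h : Distant i j) :
      LocalRel
        ((cup i ⊠ id [j, i]) ⊚
          (id [i] ⊠ cross i j h ⊠ id [i] : Diagram 𝕜 n [i, i, j, i] [i, j, i, i]) ⊚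
            (id [i, j] ⊠ cap i) :
          Diagram 𝕜 n [j, i] [i, j])
        (cross j i h.symm)
  | rotate_cross_right (i j : Fin n) (h : Distant i j) :
      LocalRel
        ((id [j, i] ⊠ cup j) ⊚
          (id [j] ⊠ cross i j h ⊠ id [j] : Diagram 𝕜 n [j, i, j, j] [j, j, i, j]) ⊚
            (cap j ⊠ id [i, j]) :
          Diagram 𝕜 n [j, i] [i, j])
        (cross j i h.symm)
  | cross_cross (i j : Fin n) (h : Distant i j) :
      LocalRel (cross i j h ⊚ cross j i h.symm : Diagram 𝕜 n [i, j] [i, j]) (id [i, j])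
  | slide_dot (i j : Fin n) (h : Distant i j) :
      LocalRel ((startdot i ⊠ id [j]) ⊚ cross i j h : Diagram 𝕜 n [j] [j, i])
        (id [j] ⊠ startdot i)
  | slide_merge (i j : Fin n) (h : Distant i j) :
      LocalRel ((merge i ⊠ id [j]) ⊚ cross i j h : Diagram 𝕜 n [i, i, j] [j, i])
        ((id [i] ⊠ cross i j h) ⊚ (cross i j h ⊠ id [i] : Diagram 𝕜 n [i, j, i] [j, i, i]) ⊚
          (id [j] ⊠ merge i))
  | slide_cross (i j l : Fin n) (hij : Distant i j) (hil : Distant i l) (hjl : Distant j l) :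
      LocalRel
        ((cross i j hij ⊠ id [l]) ⊚ (id [j] ⊠ cross i l hil : Diagram 𝕜 n [j, i, l] [j, l, i]) ⊚
            (cross j l hjl ⊠ id [i]) :
          Diagram 𝕜 n [i, j, l] [l, j, i])
        ((id [i] ⊠ cross j l hjl) ⊚ (cross i l hil ⊠ id [j] : Diagram 𝕜 n [i, l, j] [l, i, j]) ⊚
          (id [l] ⊠ cross i j hij))
  -- one colour: the two trees with four boundary edges agree, a dot cancels a trivalent vertex,
  -- an empty needle is zero
  | assoc_one (i : Fin n) :
      LocalRel (merge i ⊚ split i : Diagram 𝕜 n [i, i] [i, i])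
        ((split i ⊠ id [i]) ⊚ (id [i] ⊠ merge i))
  | unit_one (i : Fin n) :
      LocalRel ((startdot i ⊠ id [i]) ⊚ merge i : Diagram 𝕜 n [i] [i]) (id [i])
  | needle (i : Fin n) : LocalRel (split i ⊚ cap i : Diagram 𝕜 n [i] []) zero
  -- dot forcing through a line of the same colour and of an adjacent colour
  | force_same (i : Fin n) :
      LocalRel ((ddot i ⊠ id [i]) +ᵈ (id [i] ⊠ ddot i) : Diagram 𝕜 n [i] [i])
        (smul 2 (broken i))
  | force_adjacent (i j : Fin n) (h : Adjacent i j) :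
      LocalRel ((ddot j ⊠ id [i]) +ᵈ broken i : Diagram 𝕜 n [i] [i])
        ((id [i] ⊠ ddot j) +ᵈ (id [i] ⊠ ddot i))
  -- the relation imposed by killing the 6-valent vertices: in a disc with boundary `i j i j`, the
  -- `j`-line between two `i`-dots is minus the `i`-line between two `j`-dots
  | switch (i j : Fin n) (h : Adjacent i j) :
      LocalRel ((enddot i ⊠ id [j] ⊠ startdot i) +ᵈ (startdot j ⊠ id [i] ⊠ enddot j) :
          Diagram 𝕜 n [i, j] [j, i])
        zero

/-- The congruence on formal pictures generated by the generating relations and by the axioms of a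
`𝕜`-linear strict monoidal category. -/
inductive Rel : {a b : List (Fin n)} → Diagram 𝕜 n a b → Diagram 𝕜 n a b → Prop
  | of {a b} {p q : Diagram 𝕜 n a b} : LocalRel p q → Rel p q
  | refl {a b} (p : Diagram 𝕜 n a b) : Rel p p
  | symm {a b} {p q : Diagram 𝕜 n a b} : Rel p q → Rel q p
  | trans {a b} {p q r : Diagram 𝕜 n a b} : Rel p q → Rel q r → Rel p r
  | comp_congr {a b c} {p p' : Diagram 𝕜 n a b} {q q' : Diagram 𝕜 n b c} :
      Rel p p' → Rel q q' → Rel (p ⊚ q) (p' ⊚ q')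
  | tens_congr {a b c d} {p p' : Diagram 𝕜 n a b} {q q' : Diagram 𝕜 n c d} :
      Rel p p' → Rel q q' → Rel (p ⊠ q) (p' ⊠ q')
  | add_congr {a b} {p p' q q' : Diagram 𝕜 n a b} :
      Rel p p' → Rel q q' → Rel (p +ᵈ q) (p' +ᵈ q')
  | smul_congr {a b} (t : 𝕜) {p p' : Diagram 𝕜 n a b} : Rel p p' → Rel (smul t p) (smul t p')
  -- vector spaces
  | add_assoc {a b} (p q r : Diagram 𝕜 n a b) : Rel (p +ᵈ q +ᵈ r) (p +ᵈ (q +ᵈ r))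
  | add_comm {a b} (p q : Diagram 𝕜 n a b) : Rel (p +ᵈ q) (q +ᵈ p)
  | zero_add {a b} (p : Diagram 𝕜 n a b) : Rel (zero +ᵈ p) p
  | zero_smul {a b} (p : Diagram 𝕜 n a b) : Rel (smul 0 p) zero
  | one_smul {a b} (p : Diagram 𝕜 n a b) : Rel (smul 1 p) p
  | mul_smul {a b} (t t' : 𝕜) (p : Diagram 𝕜 n a b) : Rel (smul (t * t') p) (smul t (smul t' p))
  | add_smul {a b} (t t' : 𝕜) (p : Diagram 𝕜 n a b) : Rel (smul (t + t') p) (smul t p +ᵈ smul t' p)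
  | smul_add {a b} (t : 𝕜) (p q : Diagram 𝕜 n a b) : Rel (smul t (p +ᵈ q)) (smul t p +ᵈ smul t q)
  -- bilinearity of the two concatenations
  | add_comp {a b c} (p p' : Diagram 𝕜 n a b) (q : Diagram 𝕜 n b c) :
      Rel ((p +ᵈ p') ⊚ q) (p ⊚ q +ᵈ p' ⊚ q)
  | comp_add {a b c} (p : Diagram 𝕜 n a b) (q q' : Diagram 𝕜 n b c) :
      Rel (p ⊚ (q +ᵈ q')) (p ⊚ q +ᵈ p ⊚ q')
  | smul_comp {a b c} (t : 𝕜) (p : Diagram 𝕜 n a b) (q : Diagram 𝕜 n b c) :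
      Rel (smul t p ⊚ q) (smul t (p ⊚ q))
  | comp_smul {a b c} (t : 𝕜) (p : Diagram 𝕜 n a b) (q : Diagram 𝕜 n b c) :
      Rel (p ⊚ smul t q) (smul t (p ⊚ q))
  | add_tens {a b c d} (p p' : Diagram 𝕜 n a b) (q : Diagram 𝕜 n c d) :
      Rel ((p +ᵈ p') ⊠ q) (p ⊠ q +ᵈ p' ⊠ q)
  | tens_add {a b c d} (p : Diagram 𝕜 n a b) (q q' : Diagram 𝕜 n c d) :
      Rel (p ⊠ (q +ᵈ q')) (p ⊠ q +ᵈ p ⊠ q')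
  | smul_tens {a b c d} (t : 𝕜) (p : Diagram 𝕜 n a b) (q : Diagram 𝕜 n c d) :
      Rel (smul t p ⊠ q) (smul t (p ⊠ q))
  | tens_smul {a b c d} (t : 𝕜) (p : Diagram 𝕜 n a b) (q : Diagram 𝕜 n c d) :
      Rel (p ⊠ smul t q) (smul t (p ⊠ q))
  -- categories
  | id_comp {a b} (p : Diagram 𝕜 n a b) : Rel (id a ⊚ p) p
  | comp_id {a b} (p : Diagram 𝕜 n a b) : Rel (p ⊚ id b) p
  | comp_assoc {a b c d} (p : Diagram 𝕜 n a b) (q : Diagram 𝕜 n b c) (r : Diagram 𝕜 n c d) :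
      Rel ((p ⊚ q) ⊚ r) (p ⊚ (q ⊚ r))
  -- strict monoidal categories
  | id_tens_id (a b : List (Fin n)) : Rel (id a ⊠ id b : Diagram 𝕜 n (a ++ b) (a ++ b)) (id (a ++ b))
  | interchange {a b c a' b' c'} (p : Diagram 𝕜 n a b) (q : Diagram 𝕜 n b c)
      (p' : Diagram 𝕜 n a' b') (q' : Diagram 𝕜 n b' c') :
      Rel ((p ⊠ p') ⊚ (q ⊠ q')) ((p ⊚ q) ⊠ (p' ⊚ q'))
  | tens_assoc {a b c d a' b'} (p : Diagram 𝕜 n a b) (q : Diagram 𝕜 n c d)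
      (r : Diagram 𝕜 n a' b') :
      Rel (((p ⊠ q) ⊠ r) ⊚ ofEq (List.append_assoc b d b'))
        (ofEq (List.append_assoc a c a') ⊚ (p ⊠ (q ⊠ r)))
  | id_nil_tens {a b} (p : Diagram 𝕜 n a b) : Rel (id [] ⊠ p) p
  | tens_id_nil {a b} (p : Diagram 𝕜 n a b) :
      Rel ((p ⊠ id []) ⊚ ofEq (List.append_nil b)) (ofEq (List.append_nil a) ⊚ p)

instance setoid (a b : List (Fin n)) : Setoid (Diagram 𝕜 n a b) :=
  ⟨Rel, Rel.refl, Rel.symm, Rel.trans⟩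

end Diagram

open Diagram

/-- The objects of `TLC₁`: finite sequences of indices. -/
def TLC₁ (_𝕜 : Type u) (n : ℕ) : Type := List (Fin n)

/-- A sequence of indices as an object of `TLC₁`. -/
def obj (𝕜 : Type u) {n : ℕ} (s : List (Fin n)) : TLC₁ 𝕜 n := s

section Category

variable {𝕜 : Type u} [Field 𝕜] {n : ℕ}

instance : CategoryStruct.{u} (TLC₁ 𝕜 n) where
  Hom a b := Quotient (Diagram.setoid (𝕜 := 𝕜) (n := n) a b)
  id a := ⟦Diagram.id a⟧
  comp := Quotient.map₂ Diagram.comp fun _ _ h _ _ h' => Rel.comp_congr h h'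

/-- The morphism represented by a formal linear combination of pictures. -/
def mk {a b : List (Fin n)} (p : Diagram 𝕜 n a b) : obj 𝕜 a ⟶ obj 𝕜 b :=
  ⟦p⟧

theorem mk_sound {a b : List (Fin n)} {p q : Diagram 𝕜 n a b} (h : Rel p q) : mk p = mk q :=
  Quotient.sound h

theorem mk_ind {a b : TLC₁ 𝕜 n} {P : (a ⟶ b) → Prop}
    (h : ∀ p : Diagram 𝕜 n a b, P (mk p)) (q : a ⟶ b) : P q :=
  Quotient.ind h q

instance : Category.{u} (TLC₁ 𝕜 n) where
  id_comp := mk_ind fun p => mk_sound (Rel.id_comp p)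
  comp_id := mk_ind fun p => mk_sound (Rel.comp_id p)
  assoc := mk_ind fun p => mk_ind fun q => mk_ind fun r => mk_sound (Rel.comp_assoc p q r)

instance (a b : TLC₁ 𝕜 n) : Zero (a ⟶ b) := ⟨mk Diagram.zero⟩

instance (a b : TLC₁ 𝕜 n) : Add (a ⟶ b) :=
  ⟨Quotient.map₂ Diagram.add fun _ _ h _ _ h' => Rel.add_congr h h'⟩

instance (a b : TLC₁ 𝕜 n) : SMul 𝕜 (a ⟶ b) :=
  ⟨fun t => Quotient.map (Diagram.smul t) fun _ _ h => Rel.smul_congr t h⟩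

instance (a b : TLC₁ 𝕜 n) : Neg (a ⟶ b) := ⟨fun p => (-1 : 𝕜) • p⟩

theorem hom_add_comm {a b : TLC₁ 𝕜 n} (p q : a ⟶ b) : p + q = q + p := by
  induction p using mk_ind with | _ p
  induction q using mk_ind with | _ q
  exact mk_sound (Rel.add_comm p q)

theorem hom_zero_add {a b : TLC₁ 𝕜 n} (p : a ⟶ b) : 0 + p = p := by
  induction p using mk_ind with | _ p
  exact mk_sound (Rel.zero_add p)

theorem hom_add_smul {a b : TLC₁ 𝕜 n} (t t' : 𝕜) (p : a ⟶ b) :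
    (t + t') • p = t • p + t' • p := by
  induction p using mk_ind with | _ p
  exact mk_sound (Rel.add_smul t t' p)

theorem hom_one_smul {a b : TLC₁ 𝕜 n} (p : a ⟶ b) : (1 : 𝕜) • p = p := by
  induction p using mk_ind with | _ p
  exact mk_sound (Rel.one_smul p)

theorem hom_zero_smul {a b : TLC₁ 𝕜 n} (p : a ⟶ b) : (0 : 𝕜) • p = 0 := by
  induction p using mk_ind with | _ p
  exact mk_sound (Rel.zero_smul p)

theorem hom_mul_smul {a b : TLC₁ 𝕜 n} (t t' : 𝕜) (p : a ⟶ b) : (t * t') • p = t • t' • p := by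
  induction p using mk_ind with | _ p
  exact mk_sound (Rel.mul_smul t t' p)

instance (a b : TLC₁ 𝕜 n) : AddCommGroup (a ⟶ b) where
  add_assoc := mk_ind fun p => mk_ind fun q => mk_ind fun r => mk_sound (Rel.add_assoc p q r)
  add_comm := hom_add_comm
  zero_add := hom_zero_add
  add_zero p := by rw [hom_add_comm, hom_zero_add]
  nsmul := nsmulRec
  zsmul := zsmulRec
  neg_add_cancel p := by
    change (-1 : 𝕜) • p + p = 0
    conv_lhs => rw [← hom_one_smul p, ← hom_mul_smul, ← hom_add_smul]
    rw [mul_one, neg_add_cancel, hom_zero_smul]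

instance (a b : TLC₁ 𝕜 n) : Module 𝕜 (a ⟶ b) where
  one_smul := hom_one_smul
  mul_smul := hom_mul_smul
  add_smul := hom_add_smul
  zero_smul := hom_zero_smul
  smul_zero t := by
    rw [← hom_zero_smul (0 : a ⟶ b), ← hom_mul_smul, mul_zero]
  smul_add t := mk_ind fun p => mk_ind fun q => mk_sound (Rel.smul_add t p q)

theorem mk_comp_mk {a b c : List (Fin n)} (p : Diagram 𝕜 n a b) (q : Diagram 𝕜 n b c) :
    mk p ≫ mk q = mk (Diagram.comp p q) := rfl

theorem mk_add_mk {a b : List (Fin n)} (p q : Diagram 𝕜 n a b) :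
    mk p + mk q = mk (Diagram.add p q) := rfl

theorem smul_mk {a b : List (Fin n)} (t : 𝕜) (p : Diagram 𝕜 n a b) :
    t • mk p = mk (Diagram.smul t p) := rfl

instance : Preadditive (TLC₁ 𝕜 n) where
  add_comp _ _ _ p p' q := by
    induction p using mk_ind with | _ p
    induction p' using mk_ind with | _ p'
    induction q using mk_ind with | _ q
    exact mk_sound (Rel.add_comp p p' q)
  comp_add _ _ _ p q q' := by
    induction p using mk_ind with | _ p
    induction q using mk_ind with | _ q
    induction q' using mk_ind with | _ q'
    exact mk_sound (Rel.comp_add p q q')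

instance : Linear 𝕜 (TLC₁ 𝕜 n) where
  smul_comp _ _ _ t p q := by
    induction p using mk_ind with | _ p
    induction q using mk_ind with | _ q
    exact mk_sound (Rel.smul_comp t p q)
  comp_smul _ _ _ p t q := by
    induction p using mk_ind with | _ p
    induction q using mk_ind with | _ q
    exact mk_sound (Rel.comp_smul t p q)

/-- Two names of the same sequence are the same object. -/
def isoOfEq {a b : List (Fin n)} (h : a = b) :
    obj 𝕜 a ≅ obj 𝕜 b where
  hom := mk (Diagram.ofEq h)
  inv := mk (Diagram.ofEq h.symm)
  hom_inv_id := by subst h; exact mk_sound (Rel.id_comp _)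
  inv_hom_id := by subst h; exact mk_sound (Rel.id_comp _)

/-- The monoidal structure is horizontal concatenation; associators and unitors are identities. -/
instance : MonoidalCategoryStruct (TLC₁ 𝕜 n) where
  tensorObj a b := List.append a b
  tensorUnit := []
  tensorHom := Quotient.map₂ Diagram.tens fun _ _ h _ _ h' => Rel.tens_congr h h'
  whiskerLeft a _ _ := Quotient.map (Diagram.tens (Diagram.id a))
    fun _ _ h => Rel.tens_congr (Rel.refl _) h
  whiskerRight p b := Quotient.map (fun p => Diagram.tens p (Diagram.id b))
    (fun _ _ h => Rel.tens_congr h (Rel.refl _)) p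
  associator a b c := isoOfEq (List.append_assoc a b c)
  leftUnitor a := isoOfEq (List.nil_append a)
  rightUnitor a := isoOfEq (List.append_nil a)

theorem ofEq_comp_ofEq {a b c : List (Fin n)} (h : a = b) (h' : b = c) :
    mk (𝕜 := 𝕜) (Diagram.comp (Diagram.ofEq h) (Diagram.ofEq h')) =
      mk (Diagram.ofEq (h.trans h')) := by
  subst h; exact mk_sound (Rel.id_comp _)

theorem ofEq_tens_ofEq {a b c d : List (Fin n)} (h : a = b) (h' : c = d) :
    mk (𝕜 := 𝕜) (Diagram.tens (Diagram.ofEq h) (Diagram.ofEq h')) =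
      mk (Diagram.ofEq (congrArg₂ List.append h h')) := by
  subst h; subst h'; exact mk_sound (Rel.id_tens_id _ _)

theorem mk_tens_mk {a b c d : List (Fin n)} (p : Diagram 𝕜 n a b) (q : Diagram 𝕜 n c d) :
    mk p ⊗ₘ mk q = mk (Diagram.tens p q) := rfl

instance : MonoidalCategory (TLC₁ 𝕜 n) :=
  MonoidalCategory.ofTensorHom
    (id_tensorHom_id := fun a b => mk_sound (Rel.id_tens_id a b))
    (id_tensorHom := fun _ _ _ => mk_ind fun _ => rfl)
    (tensorHom_id := fun {_ _} p _ => by induction p using mk_ind with | _ p; rfl)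
    (tensorHom_comp_tensorHom := fun {_ _ _ _ _ _} p p' q q' => by
      induction p using mk_ind with | _ p
      induction q using mk_ind with | _ q
      induction p' using mk_ind with | _ p'
      induction q' using mk_ind with | _ q'
      exact mk_sound (Rel.interchange p q p' q'))
    (associator_naturality := fun {_ _ _ _ _ _} p q r => by
      induction p using mk_ind with | _ p
      induction q using mk_ind with | _ q
      induction r using mk_ind with | _ r
      exact mk_sound (Rel.tens_assoc p q r))
    (leftUnitor_naturality := fun {_ _} p => by
      induction p using mk_ind with | _ p
      exact mk_sound (((Rel.comp_id _).trans (Rel.id_nil_tens p)).trans (Rel.id_comp p).symm))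
    (rightUnitor_naturality := fun {_ _} p => by
      induction p using mk_ind with | _ p
      exact mk_sound (Rel.tens_id_nil p))
    (pentagon := fun a b c d => by
      have h1 : (α_ a b c).hom ⊗ₘ 𝟙 d = mk (Diagram.ofEq (𝕜 := 𝕜)
        (congrArg₂ List.append (List.append_assoc a b c) rfl)) := ofEq_tens_ofEq _ _
      have h2 : 𝟙 a ⊗ₘ (α_ b c d).hom = mk (Diagram.ofEq (𝕜 := 𝕜)
        (congrArg₂ List.append rfl (List.append_assoc b c d))) := ofEq_tens_ofEq _ _
      rw [h1, h2]
      refine (congrArg (_ ≫ ·) (ofEq_comp_ofEq _ _)).trans ?_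
      exact (ofEq_comp_ofEq _ _).trans (ofEq_comp_ofEq _ _).symm)
    (triangle := fun a b => by
      have h1 : (ρ_ a).hom ⊗ₘ 𝟙 b = mk (Diagram.ofEq (𝕜 := 𝕜)
        (congrArg₂ List.append (List.append_nil a) rfl)) := ofEq_tens_ofEq _ _
      have h2 : 𝟙 a ⊗ₘ (λ_ b).hom = mk (Diagram.ofEq (𝕜 := 𝕜)
        (congrArg₂ List.append rfl (List.nil_append b))) := ofEq_tens_ofEq _ _
      rw [h1, h2]
      exact ofEq_comp_ofEq _ _)

instance : MonoidalPreadditive (TLC₁ 𝕜 n) where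
  whiskerLeft_zero {a b c} := by
    have h : (0 : b ⟶ c) = (0 : 𝕜) • (0 : b ⟶ c) := (hom_zero_smul _).symm
    rw [h]
    exact mk_sound ((Rel.tens_smul 0 (Diagram.id a) Diagram.zero).trans (Rel.zero_smul _))
  zero_whiskerRight {a b c} := by
    have h : (0 : b ⟶ c) = (0 : 𝕜) • (0 : b ⟶ c) := (hom_zero_smul _).symm
    rw [h]
    exact mk_sound ((Rel.smul_tens 0 Diagram.zero (Diagram.id a)).trans (Rel.zero_smul _))
  whiskerLeft_add {a _ _} := mk_ind fun p => mk_ind fun q =>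
    mk_sound (Rel.tens_add (Diagram.id a) p q)
  add_whiskerRight {a _ _} := mk_ind fun p => mk_ind fun q =>
    mk_sound (Rel.add_tens p q (Diagram.id a))

instance : MonoidalLinear 𝕜 (TLC₁ 𝕜 n) where
  whiskerLeft_smul a _ _ t := mk_ind fun p => mk_sound (Rel.tens_smul t (Diagram.id a) p)
  smul_whiskerRight t _ _ p a := by
    induction p using mk_ind with | _ p
    exact mk_sound (Rel.smul_tens t p (Diagram.id a))

theorem end_unit_comm (p q : 𝟙_ (TLC₁ 𝕜 n) ⟶ 𝟙_ (TLC₁ 𝕜 n)) : p ≫ q = q ≫ p := by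
  have h := whisker_exchange p q
  simp only [id_whiskerLeft, whiskerRight_id, ← unitors_equal, ← unitors_inv_equal, Category.assoc,
    Iso.inv_hom_id_assoc, cancel_epi] at h
  simpa only [← Category.assoc, cancel_mono] using h.symm

/-- Pictures without boundary form a commutative ring. -/
noncomputable instance : CommRing (End (𝟙_ (TLC₁ 𝕜 n))) where
  mul_comm p q := end_unit_comm q p

end Category

/-! ## The TL ideal -/

section TLIdeal

variable {𝕜 : Type u} [Field 𝕜] {n : ℕ}

/-- The double dot of colour `i`, as an endomorphism of the empty sequence. -/
def ddotEnd (𝕜 : Type u) [Field 𝕜] {n : ℕ} (i : Fin n) : End (𝟙_ (TLC₁ 𝕜 n)) :=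
  mk (Diagram.ddot i)

/-- A polynomial of `R` as a combination of pictures without boundary: the homomorphism of
`𝕜`-algebras that sends each `f_i` to the double dot of colour `i`. -/
noncomputable def box (hchar : ¬ ringChar 𝕜 ∣ 2 * (n + 1)) :
    R 𝕜 n →ₐ[𝕜] End (𝟙_ (TLC₁ 𝕜 n)) :=
  (MvPolynomial.aeval fun i : Fin n => ddotEnd 𝕜 i).comp
    (toF hchar)

/-- The action of `R` on `HOM(∅, s)`: the polynomial is placed to the left of the picture. -/
noncomputable def act (hchar : ¬ ringChar 𝕜 ∣ 2 * (n + 1)) {s : TLC₁ 𝕜 n} (r : R 𝕜 n)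
    (p : 𝟙_ (TLC₁ 𝕜 n) ⟶ s) : 𝟙_ (TLC₁ 𝕜 n) ⟶ s :=
  (λ_ (𝟙_ (TLC₁ 𝕜 n))).inv ≫ ((box hchar r : 𝟙_ (TLC₁ 𝕜 n) ⟶ 𝟙_ (TLC₁ 𝕜 n)) ⊗ₘ p) ≫ (λ_ s).hom

/-- The picture with one boundary dot for every entry of `s`. -/
def phiDiagram (𝕜 : Type u) {n : ℕ} : (s : List (Fin n)) → Diagram 𝕜 n [] s
  | [] => Diagram.id []
  | i :: s => Diagram.tens (Diagram.startdot i) (phiDiagram 𝕜 s)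

/-- The morphism `φ_s : ∅ → s`. -/
def phi (𝕜 : Type u) [Field 𝕜] {n : ℕ} (s : List (Fin n)) :
    𝟙_ (TLC₁ 𝕜 n) ⟶ obj 𝕜 s :=
  mk (phiDiagram 𝕜 s)

theorem act_eq_comp (hchar : ¬ ringChar 𝕜 ∣ 2 * (n + 1)) {s : TLC₁ 𝕜 n} (r : R 𝕜 n)
    (p : 𝟙_ (TLC₁ 𝕜 n) ⟶ s) :
    act hchar r p = (box hchar r : 𝟙_ (TLC₁ 𝕜 n) ⟶ 𝟙_ (TLC₁ 𝕜 n)) ≫ p := by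
  rw [act, MonoidalCategory.tensorHom_def, id_whiskerLeft, whiskerRight_id, ← unitors_equal, ← unitors_inv_equal]
  simp

/-- The TL ideal of `s`: the kernel of `R → HOM(∅, s)`, `r ↦ r · φ_s`. -/
noncomputable def TLIdeal (hchar : ¬ ringChar 𝕜 ∣ 2 * (n + 1)) (s : List (Fin n)) :
    Ideal (R 𝕜 n) where
  carrier := {r | act hchar r (phi 𝕜 s) = 0}
  zero_mem' := by
    change act hchar 0 (phi 𝕜 s) = 0
    rw [act_eq_comp, map_zero]
    exact Limits.zero_comp
  add_mem' {r r'} hr hr' := by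
    change act hchar r (phi 𝕜 s) = 0 at hr
    change act hchar r' (phi 𝕜 s) = 0 at hr'
    change act hchar (r + r') (phi 𝕜 s) = 0
    rw [act_eq_comp] at hr hr' ⊢
    rw [map_add]
    refine (Preadditive.add_comp (C := TLC₁ 𝕜 n) _ _ _ _ _ _).trans ?_
    rw [hr, hr', add_zero]
  smul_mem' c r hr := by
    change act hchar r (phi 𝕜 s) = 0 at hr
    change act hchar (c * r) (phi 𝕜 s) = 0
    rw [act_eq_comp] at hr ⊢
    rw [mul_comm, map_mul, End.mul_def, Category.assoc, hr, Limits.comp_zero]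

end TLIdeal

end TLC

/-! Everything follows from one family of identities: for i < j the linear form L = f_i + 2f_{i+1} +
⋯ + 2f_{j-1} + f_j kills the picture of two dots i, j (`formEnd_twoDots`). If i or j is absent from
s, closing its dot produces the missing factor f_i or f_j; the picture of dots φ_s is obtained from
the remaining dots by adding further ones. Hence z kills φ_s.

The identity is proved by induction on j - i. For adjacent colours it is the switch relation with a
dot on each bottom boundary point.

For the step put k = i + 1 and let f_k + u be the form of the pair k, j, so that u involves only
colours distant from i. Closing the k-dot in the induction hypothesis shows that g = f_k(f_k + u)
kills a single j-dot. Place g inside a needle of colour i and compute in two ways. Write b for the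
broken i-line. Forcing turns g on the right of the line into (F - b)(F - b + u) on its left, where F
= f_i + f_k; since b² = f_i b, this is F(F + u) - (f_i + 2f_k + u)b (`rightScalar_force`). The first
term leaves an empty needle, which is 0, and b opens the needle, so the needle equals -L times an
i-dot, with L the form of i, j (`split_rightScalar_cap`). On the other hand a j-dot beside the
needle can be pulled inside, because j is distant from i, and there g kills it. So L kills the two
dots (`startdot_tensor_startdot_of_needle`). -/

namespace TLC

/-! ## Scalars in a monoidal category -/

section Scalars

universe v w

variable {C : Type w} [Category.{v} C] [MonoidalCategory C]

/-- An endomorphism of the unit, placed to the left of `X`. -/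
def leftScalar (g : 𝟙_ C ⟶ 𝟙_ C) (X : C) : X ⟶ X := (λ_ X).inv ≫ g ▷ X ≫ (λ_ X).hom

/-- An endomorphism of the unit, placed to the right of `X`. -/
def rightScalar (g : 𝟙_ C ⟶ 𝟙_ C) (X : C) : X ⟶ X := (ρ_ X).inv ≫ X ◁ g ≫ (ρ_ X).hom

theorem leftScalar_naturality (g : 𝟙_ C ⟶ 𝟙_ C) {X Y : C} (p : X ⟶ Y) :
    leftScalar g X ≫ p = p ≫ leftScalar g Y := by
  simp only [leftScalar, Category.assoc]
  rw [← leftUnitor_naturality, ← whisker_exchange_assoc, leftUnitor_inv_naturality_assoc]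

theorem leftScalar_unit (g : 𝟙_ C ⟶ 𝟙_ C) : leftScalar g (𝟙_ C) = g := by
  rw [leftScalar, unitors_equal, unitors_inv_equal, whiskerRight_id]
  simp

theorem leftScalar_whiskerRight (g : 𝟙_ C ⟶ 𝟙_ C) (X Y : C) :
    leftScalar g X ▷ Y = leftScalar g (X ⊗ Y) := by
  simp only [leftScalar]
  monoidal

/-- Both sides place g in the region between the two strands. This is how a scalar enters the
needle. -/
theorem whiskerLeft_leftScalar (g : 𝟙_ C ⟶ 𝟙_ C) (X Y : C) :
    X ◁ leftScalar g Y = rightScalar g X ▷ Y := by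
  simp only [leftScalar, rightScalar]
  monoidal

theorem leftScalar_comp (g h : 𝟙_ C ⟶ 𝟙_ C) (X : C) :
    leftScalar (g ≫ h) X = leftScalar g X ≫ leftScalar h X := by
  simp [leftScalar]

theorem rightScalar_comp (g h : 𝟙_ C ⟶ 𝟙_ C) (X : C) :
    rightScalar (g ≫ h) X = rightScalar g X ≫ rightScalar h X := by
  simp [rightScalar]

variable [Preadditive C] [MonoidalPreadditive C]

theorem leftScalar_add (g h : 𝟙_ C ⟶ 𝟙_ C) (X : C) :
    leftScalar (g + h) X = leftScalar g X + leftScalar h X := by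
  simp [leftScalar]

theorem rightScalar_add (g h : 𝟙_ C ⟶ 𝟙_ C) (X : C) :
    rightScalar (g + h) X = rightScalar g X + rightScalar h X := by
  simp [rightScalar]

end Scalars

/-! ## Dots, caps and crossings in a monoidal category -/

section Dots

universe v w

variable {C : Type w} [Category.{v} C] [MonoidalCategory C] {X Y : C}

/-- By rotation e is s followed by a cap; cup and cap then form a zigzag, which straightens. -/
theorem cup_whiskerLeft_enddot {s : 𝟙_ C ⟶ X} {e : X ⟶ 𝟙_ C} {cup : 𝟙_ C ⟶ X ⊗ X}
    {cap : X ⊗ X ⟶ 𝟙_ C}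
    (zigzag : cup ▷ X ≫ (α_ X X X).hom ≫ X ◁ cap = (λ_ X).hom ≫ (ρ_ X).inv)
    (rotate : X ◁ s ≫ cap = (ρ_ X).hom ≫ e) :
    cup ≫ X ◁ e ≫ (ρ_ X).hom = s := by
  have h1 : s = s ≫ (λ_ X).inv ≫ (cup ▷ X ≫ (α_ X X X).hom ≫ X ◁ cap) ≫ (ρ_ X).hom := by
    rw [zigzag]; simp
  have h2 : s ≫ (λ_ X).inv ≫ (cup ▷ X ≫ (α_ X X X).hom ≫ X ◁ cap) ≫ (ρ_ X).hom =
      cup ≫ X ◁ ((ρ_ X).inv ≫ X ◁ s ≫ cap) ≫ (ρ_ X).hom := by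
    rw [leftUnitor_inv_naturality_assoc, Category.assoc, whisker_exchange_assoc]
    monoidal
  rw [h1, h2, rotate]
  simp

theorem cup_whiskerRight_enddot {s : 𝟙_ C ⟶ X} {e : X ⟶ 𝟙_ C} {cup : 𝟙_ C ⟶ X ⊗ X}
    {cap : X ⊗ X ⟶ 𝟙_ C}
    (zigzag : X ◁ cup ≫ (α_ X X X).inv ≫ cap ▷ X = (ρ_ X).hom ≫ (λ_ X).inv)
    (rotate : s ▷ X ≫ cap = (λ_ X).hom ≫ e) :
    cup ≫ e ▷ X ≫ (λ_ X).hom = s := by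
  have h1 : s = s ≫ (ρ_ X).inv ≫ (X ◁ cup ≫ (α_ X X X).inv ≫ cap ▷ X) ≫ (λ_ X).hom := by
    rw [zigzag]; simp
  have h2 : s ≫ (ρ_ X).inv ≫ (X ◁ cup ≫ (α_ X X X).inv ≫ cap ▷ X) ≫ (λ_ X).hom =
      cup ≫ ((λ_ X).inv ≫ s ▷ X ≫ cap) ▷ X ≫ (λ_ X).hom := by
    rw [rightUnitor_inv_naturality_assoc, Category.assoc, ← whisker_exchange_assoc]
    monoidal
  rw [h1, h2, rotate]
  simp

/-- The split is a merge rotated by a cup on the left. The dot on the left leg shrinks the cup to a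
dot on the merge, where the unit relation applies. -/
theorem split_whiskerRight_enddot {s : 𝟙_ C ⟶ X} {e : X ⟶ 𝟙_ C} {cup : 𝟙_ C ⟶ X ⊗ X}
    {merge : X ⊗ X ⟶ X} {split : X ⟶ X ⊗ X}
    (hcup : cup ≫ e ▷ X ≫ (λ_ X).hom = s)
    (rotate : cup ▷ X ≫ (α_ X X X).hom ≫ X ◁ merge = (λ_ X).hom ≫ split)
    (unit : s ▷ X ≫ merge = (λ_ X).hom) :
    split ≫ e ▷ X ≫ (λ_ X).hom = 𝟙 X := by
  have h1 : split = (λ_ X).inv ≫ cup ▷ X ≫ (α_ X X X).hom ≫ X ◁ merge := by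
    rw [rotate]; simp
  have h2 : ((λ_ X).inv ≫ cup ▷ X ≫ (α_ X X X).hom ≫ X ◁ merge) ≫ e ▷ X ≫ (λ_ X).hom =
      (λ_ X).inv ≫ (cup ≫ e ▷ X ≫ (λ_ X).hom) ▷ X ≫ merge := by
    simp only [Category.assoc]
    rw [whisker_exchange_assoc]
    monoidal
  rw [h1, h2, hcup, unit]
  simp

/-- The defining relations slide only the dot with its edge going up. Writing c' as c rotated by a
cup on the right and a cap on the left, e shrinks the cup to s, s slides through c, and the cap
turns it back into e. -/
theorem cross_whiskerLeft_enddot {s : 𝟙_ C ⟶ Y} {e : Y ⟶ 𝟙_ C} {cup : 𝟙_ C ⟶ Y ⊗ Y}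
    {cap : Y ⊗ Y ⟶ 𝟙_ C} {c : X ⊗ Y ⟶ Y ⊗ X} {c' : Y ⊗ X ⟶ X ⊗ Y}
    (hcup : cup ≫ Y ◁ e ≫ (ρ_ Y).hom = s)
    (rotate_dot : Y ◁ s ≫ cap = (ρ_ Y).hom ≫ e)
    (rotate_cross : (Y ⊗ X) ◁ cup ≫ (α_ Y X (Y ⊗ Y)).hom ≫ Y ◁ (α_ X Y Y).inv ≫ Y ◁ c ▷ Y ≫
      Y ◁ (α_ Y X Y).hom ≫ (α_ Y Y (X ⊗ Y)).inv ≫ cap ▷ (X ⊗ Y) =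
        (ρ_ (Y ⊗ X)).hom ≫ c' ≫ (λ_ (X ⊗ Y)).inv)
    (slide : s ▷ X ≫ c' = (λ_ X).hom ≫ (ρ_ X).inv ≫ X ◁ s)
    (cross_cross : c' ≫ c = 𝟙 _) :
    c' ≫ X ◁ e ≫ (ρ_ X).hom = e ▷ X ≫ (λ_ X).hom := by
  have h1 : X ◁ s ≫ c = (ρ_ X).hom ≫ (λ_ X).inv ≫ s ▷ X := by
    have : X ◁ s = (ρ_ X).hom ≫ (λ_ X).inv ≫ s ▷ X ≫ c' := by rw [slide]; simp
    rw [this]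
    simp [cross_cross]
  have h2 : c' = (ρ_ (Y ⊗ X)).inv ≫ ((Y ⊗ X) ◁ cup ≫ (α_ Y X (Y ⊗ Y)).hom ≫
      Y ◁ (α_ X Y Y).inv ≫ Y ◁ c ▷ Y ≫ Y ◁ (α_ Y X Y).hom ≫ (α_ Y Y (X ⊗ Y)).inv ≫
        cap ▷ (X ⊗ Y)) ≫ (λ_ (X ⊗ Y)).hom := by
    rw [rotate_cross]; simp
  have h3 : c' ≫ X ◁ e ≫ (ρ_ X).hom =
      Y ◁ ((ρ_ X).inv ≫ X ◁ (cup ≫ Y ◁ e ≫ (ρ_ Y).hom) ≫ c) ≫ (α_ Y Y X).inv ≫ cap ▷ X ≫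
        (λ_ X).hom := by
    -- Interchange lowers e past the crossing here and past the cap in `h5`, until it meets the cup.
    have h4 : (α_ X Y Y).inv ≫ c ▷ Y ≫ (α_ Y X Y).hom ≫ Y ◁ X ◁ e =
        X ◁ Y ◁ e ≫ (α_ X Y (𝟙_ C)).inv ≫ c ▷ (𝟙_ C) ≫ (α_ Y X (𝟙_ C)).hom := by
      rw [← associator_naturality_right, ← whisker_exchange_assoc]
      simp
    have h5 : cap ▷ (X ⊗ Y) ≫ (λ_ (X ⊗ Y)).hom ≫ X ◁ e =
        (α_ Y Y (X ⊗ Y)).hom ≫ Y ◁ Y ◁ X ◁ e ≫ (α_ Y Y _).inv ≫ cap ▷ _ ≫ (λ_ _).hom := by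
      rw [← leftUnitor_naturality, ← whisker_exchange_assoc]
      simp
    conv_lhs => rw [h2]
    simp only [Category.assoc]
    rw [reassoc_of% h5]
    simp only [Iso.inv_hom_id_assoc]
    have h6 := congrArg (fun t => Y ◁ t) h4
    simp only [MonoidalCategory.whiskerLeft_comp] at h6
    rw [reassoc_of% h6]
    monoidal
  rw [h3, hcup, h1]
  have h7 : Y ◁ ((ρ_ X).inv ≫ (ρ_ X).hom ≫ (λ_ X).inv ≫ s ▷ X) ≫ (α_ Y Y X).inv ≫ cap ▷ X ≫
      (λ_ X).hom = ((ρ_ Y).inv ≫ Y ◁ s ≫ cap) ▷ X ≫ (λ_ X).hom := by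
    monoidal
  rw [h7, rotate_dot]
  simp

/-- The upper dot passes first, stretching the edge across the line; then the lower dot follows. -/
theorem leftScalar_eq_rightScalar_of_cross {s : 𝟙_ C ⟶ Y} {e : Y ⟶ 𝟙_ C} {c' : Y ⊗ X ⟶ X ⊗ Y}
    (slide_startdot : s ▷ X ≫ c' = (λ_ X).hom ≫ (ρ_ X).inv ≫ X ◁ s)
    (slide_enddot : c' ≫ X ◁ e ≫ (ρ_ X).hom = e ▷ X ≫ (λ_ X).hom) :
    leftScalar (s ≫ e) X = rightScalar (s ≫ e) X := by
  rw [leftScalar, rightScalar, comp_whiskerRight, Category.assoc, ← slide_enddot,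
    reassoc_of% slide_startdot]
  simp

theorem startdot_tensor_startdot_enddot_left (s : 𝟙_ C ⟶ X) (e : X ⟶ 𝟙_ C) (s' : 𝟙_ C ⟶ Y) :
    (λ_ (𝟙_ C)).inv ≫ (s ⊗ₘ s') ≫ e ▷ Y ≫ (λ_ Y).hom = (s ≫ e) ≫ s' := by
  rw [MonoidalCategory.tensorHom_def, Category.assoc, whisker_exchange_assoc,
    leftUnitor_naturality]
  have := leftScalar_unit (s ≫ e)
  simp only [leftScalar, comp_whiskerRight, Category.assoc] at this
  rw [reassoc_of% this, Category.assoc]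

theorem startdot_tensor_startdot_enddot_right (s : 𝟙_ C ⟶ X) (s' : 𝟙_ C ⟶ Y) (e' : Y ⟶ 𝟙_ C) :
    (λ_ (𝟙_ C)).inv ≫ (s ⊗ₘ s') ≫ X ◁ e' ≫ (ρ_ X).hom = (s' ≫ e') ≫ s := by
  rw [MonoidalCategory.tensorHom_def', Category.assoc, ← whisker_exchange_assoc,
    rightUnitor_naturality, ← leftUnitor_inv_naturality_assoc, ← leftUnitor_inv_naturality_assoc,
    unitors_inv_equal, Iso.inv_hom_id_assoc, Category.assoc]

theorem startdot_tensor_startdot_cross {s : 𝟙_ C ⟶ X} {s' : 𝟙_ C ⟶ Y} {c : X ⊗ Y ⟶ Y ⊗ X}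
    (slide : s ▷ Y ≫ c = (λ_ Y).hom ≫ (ρ_ Y).inv ≫ Y ◁ s) :
    (λ_ (𝟙_ C)).inv ≫ (s ⊗ₘ s') ≫ c = (λ_ (𝟙_ C)).inv ≫ (s' ⊗ₘ s) := by
  rw [MonoidalCategory.tensorHom_def', Category.assoc, slide, leftUnitor_naturality_assoc,
    rightUnitor_inv_naturality_assoc, ← MonoidalCategory.tensorHom_def, Iso.inv_hom_id_assoc,
    ← unitors_inv_equal]

theorem tensorHom_eq_comp_whiskerLeft (s : 𝟙_ C ⟶ X) (p : 𝟙_ C ⟶ Y) :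
    (λ_ (𝟙_ C)).inv ≫ (s ⊗ₘ p) = s ≫ (ρ_ X).inv ≫ X ◁ p := by
  rw [rightUnitor_inv_naturality_assoc, ← MonoidalCategory.tensorHom_def, unitors_inv_equal]

theorem tensorHom_comp_eq_comp_tensorHom (s : 𝟙_ C ⟶ X) {Z : C} (p : 𝟙_ C ⟶ Y) (q : Y ⟶ Z) :
    (λ_ (𝟙_ C)).inv ≫ (s ⊗ₘ p ≫ q) = p ≫ (λ_ Y).inv ≫ (s ⊗ₘ q) := by
  rw [leftUnitor_inv_naturality_assoc, MonoidalCategory.tensorHom_def',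
    MonoidalCategory.tensorHom_def', MonoidalCategory.whiskerLeft_comp, Category.assoc]

theorem tensorHom_comp_eq_comp_whiskerLeft (s : 𝟙_ C ⟶ X) {Z : C} (p : 𝟙_ C ⟶ Y) (q : Y ⟶ Z) :
    (λ_ (𝟙_ C)).inv ≫ (s ⊗ₘ p ≫ q) = ((λ_ (𝟙_ C)).inv ≫ (s ⊗ₘ p)) ≫ X ◁ q := by
  rw [Category.assoc, MonoidalCategory.tensorHom_def, MonoidalCategory.tensorHom_def,
    MonoidalCategory.whiskerLeft_comp, Category.assoc]

variable [Preadditive C]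

/-- With dots on both bottom points, the broken strand of each summand closes to a double dot; the
order of the two top dots is reversed. -/
theorem startdot_tensor_startdot_of_switch {s : 𝟙_ C ⟶ X} {e : X ⟶ 𝟙_ C} {s' : 𝟙_ C ⟶ Y}
    {e' : Y ⟶ 𝟙_ C}
    (switch : e ▷ Y ≫ (λ_ Y).hom ≫ (ρ_ Y).inv ≫ Y ◁ s +
      X ◁ e' ≫ (ρ_ X).hom ≫ (λ_ X).inv ≫ s' ▷ X = 0) :
    (s ≫ e + s' ≫ e') ≫ (λ_ (𝟙_ C)).inv ≫ (s' ⊗ₘ s) = 0 := by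
  have h := congrArg (fun t => (λ_ (𝟙_ C)).inv ≫ (s ⊗ₘ s') ≫ t) switch
  simp only [Preadditive.comp_add, Limits.comp_zero] at h
  rw [← h, Preadditive.add_comp]
  have h1 : (s ≫ e) ≫ (λ_ (𝟙_ C)).inv ≫ (s' ⊗ₘ s) =
      (λ_ (𝟙_ C)).inv ≫ (s ⊗ₘ s') ≫ e ▷ Y ≫ (λ_ Y).hom ≫ (ρ_ Y).inv ≫ Y ◁ s := by
    rw [reassoc_of% startdot_tensor_startdot_enddot_left s e s', rightUnitor_inv_naturality_assoc,
      ← MonoidalCategory.tensorHom_def, ← unitors_inv_equal, Category.assoc]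
  have h2 : (s' ≫ e') ≫ (λ_ (𝟙_ C)).inv ≫ (s' ⊗ₘ s) =
      (λ_ (𝟙_ C)).inv ≫ (s ⊗ₘ s') ≫ X ◁ e' ≫ (ρ_ X).hom ≫ (λ_ X).inv ≫ s' ▷ X := by
    rw [reassoc_of% startdot_tensor_startdot_enddot_right s s' e',
      leftUnitor_inv_naturality_assoc s,
      ← MonoidalCategory.tensorHom_def', Category.assoc]
  rw [h1, h2]

variable [MonoidalPreadditive C]

/-- Moving the scalar `f (f + u)` through a line, where `f` is of an adjacent colour and `u` is
invariant. -/
theorem rightScalar_force {s : 𝟙_ C ⟶ X} {e : X ⟶ 𝟙_ C} {f u : 𝟙_ C ⟶ 𝟙_ C}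
    (same : leftScalar (s ≫ e) X + rightScalar (s ≫ e) X = e ≫ s + e ≫ s)
    (adjacent : leftScalar f X + e ≫ s = rightScalar f X + rightScalar (s ≫ e) X)
    (distant : leftScalar u X = rightScalar u X) :
    rightScalar (f ≫ (f + u)) X + leftScalar (s ≫ e + f + (f + u)) X ≫ e ≫ s =
      leftScalar ((s ≫ e + f) ≫ (s ≫ e + (f + u))) X := by
  have hf : rightScalar f X = leftScalar f X + leftScalar (s ≫ e) X - e ≫ s := by
    rw [eq_sub_of_add_eq adjacent.symm, eq_sub_of_add_eq' same]
    abel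
  -- The middle of the twice broken line is a free double dot, so b² = f_i b.
  have hb : (e ≫ s) ≫ e ≫ s = leftScalar (s ≫ e) X ≫ e ≫ s := by
    rw [reassoc_of% leftScalar_naturality (s ≫ e) e, leftScalar_unit]
    simp
  have hc (g) : (e ≫ s) ≫ leftScalar g X = leftScalar g X ≫ e ≫ s :=
    (leftScalar_naturality g _).symm
  simp only [rightScalar_comp, leftScalar_comp, rightScalar_add, leftScalar_add, ← distant, hf,
    Preadditive.add_comp, Preadditive.comp_add, Preadditive.sub_comp, Preadditive.comp_sub, hb, hc]
  abel

/-- Forcing is applied to the left leg. The scalar h leaves the needle, which is then empty; the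
broken leg opens it into a single line ending in a dot. -/
theorem split_rightScalar_cap {s : 𝟙_ C ⟶ X} {e : X ⟶ 𝟙_ C} {cap : X ⊗ X ⟶ 𝟙_ C}
    {split : X ⟶ X ⊗ X} {g h w : 𝟙_ C ⟶ 𝟙_ C}
    (hsplit : split ≫ e ▷ X ≫ (λ_ X).hom = 𝟙 X)
    (rotate_dot : s ▷ X ≫ cap = (λ_ X).hom ≫ e)
    (needle : split ≫ cap = 0)
    (force : rightScalar g X + leftScalar w X ≫ e ≫ s = leftScalar h X) :
    split ≫ rightScalar g X ▷ X ≫ cap = -(leftScalar w X ≫ e) := by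
  have h1 : split ≫ (leftScalar w X ≫ e ≫ s) ▷ X ≫ cap = leftScalar w X ≫ e := by
    rw [comp_whiskerRight, comp_whiskerRight, leftScalar_whiskerRight, Category.assoc,
      Category.assoc, rotate_dot, ← reassoc_of% leftScalar_naturality w split,
      reassoc_of% hsplit]
  have h2 : split ≫ leftScalar h X ▷ X ≫ cap = 0 := by
    rw [leftScalar_whiskerRight, ← reassoc_of% leftScalar_naturality h split, needle,
      Limits.comp_zero]
  rw [eq_neg_iff_add_eq_zero, ← h1, ← h2, ← force, MonoidalPreadditive.add_whiskerRight,
    Preadditive.add_comp, Preadditive.comp_add]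

theorem startdot_tensor_startdot_of_needle {s : 𝟙_ C ⟶ X} {e : X ⟶ 𝟙_ C} {cup : 𝟙_ C ⟶ X ⊗ X}
    {cap : X ⊗ X ⟶ 𝟙_ C} {split : X ⟶ X ⊗ X} {s' : 𝟙_ C ⟶ Y} {c : Y ⊗ X ⟶ X ⊗ Y}
    {g w : 𝟙_ C ⟶ 𝟙_ C}
    (hcup : cup ≫ X ◁ e ≫ (ρ_ X).hom = s)
    (slide : s' ▷ X ≫ c = (λ_ X).hom ≫ (ρ_ X).inv ≫ X ◁ s')
    (hneedle : split ≫ rightScalar g X ▷ X ≫ cap = -(leftScalar w X ≫ e))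
    (hg : g ≫ s' = 0) :
    w ≫ (λ_ (𝟙_ C)).inv ≫ (s ⊗ₘ s') = 0 := by
  have h1 : leftScalar w X ≫ e ≫ s' = 0 := by
    -- On the left g and the dot s' sit inside the needle and the edge of s' leaves across the right
    -- leg; sliding the dot out gives the right side.
    have h2 : split ≫ X ◁ ((λ_ X).inv ≫ (g ≫ s') ▷ X ≫ c) ≫ (α_ X X Y).inv ≫ cap ▷ Y ≫
        (λ_ Y).hom = (split ≫ rightScalar g X ▷ X ≫ cap) ≫ s' := by
      have h3 : X ◁ X ◁ s' ≫ (α_ X X Y).inv ≫ cap ▷ Y ≫ (λ_ Y).hom =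
          X ◁ (ρ_ X).hom ≫ cap ≫ s' := by
        rw [associator_inv_naturality_right_assoc, whisker_exchange_assoc, leftUnitor_naturality,
          unitors_equal, rightUnitor_naturality_assoc]
        simp
      rw [comp_whiskerRight, Category.assoc, slide, ← whiskerLeft_leftScalar, leftScalar]
      simp only [MonoidalCategory.whiskerLeft_comp, Category.assoc]
      rw [h3]
      simp
    rw [hg, hneedle] at h2
    simpa using h2
  -- A cup bends the bottom end of the line up to the left of s', turning e into s.
  have h3 : w ≫ (λ_ (𝟙_ C)).inv ≫ (s ⊗ₘ s') = cup ≫ X ◁ (leftScalar w X ≫ e ≫ s') := by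
    have h4 : cup ≫ X ◁ e = (ρ_ (𝟙_ C)).inv ≫ s ▷ 𝟙_ C := by
      rw [← rightUnitor_inv_naturality, ← hcup]
      simp
    rw [← Category.assoc (leftScalar w X), leftScalar_naturality, leftScalar_unit, Category.assoc,
      MonoidalCategory.whiskerLeft_comp, reassoc_of% h4, ← MonoidalCategory.tensorHom_def,
      MonoidalCategory.tensorHom_def', MonoidalCategory.tensorHom_def', ← unitors_inv_equal,
      ← leftUnitor_inv_naturality_assoc, ← leftUnitor_inv_naturality_assoc, Category.assoc]
  rw [h3, h1]
  simp

end Dots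
/-! ## The generators as morphisms of `TLC₁` -/

section Generators

variable (𝕜 : Type u) [Field 𝕜] {n : ℕ}

/-- The dot `∅ ⟶ [i]`. -/
def startdotHom (i : Fin n) : 𝟙_ (TLC₁ 𝕜 n) ⟶ obj 𝕜 [i] := mk (Diagram.startdot i)

/-- The dot `[i] ⟶ ∅`. -/
def enddotHom (i : Fin n) : obj 𝕜 [i] ⟶ 𝟙_ (TLC₁ 𝕜 n) := mk (Diagram.enddot i)

/-- The cup of colour `i`. -/
def cupHom (i : Fin n) : 𝟙_ (TLC₁ 𝕜 n) ⟶ obj 𝕜 [i] ⊗ obj 𝕜 [i] := mk (Diagram.cup i)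

/-- The cap of colour `i`. -/
def capHom (i : Fin n) : obj 𝕜 [i] ⊗ obj 𝕜 [i] ⟶ 𝟙_ (TLC₁ 𝕜 n) := mk (Diagram.cap i)

/-- The trivalent vertex with two edges down. -/
def mergeHom (i : Fin n) : obj 𝕜 [i] ⊗ obj 𝕜 [i] ⟶ obj 𝕜 [i] := mk (Diagram.merge i)

/-- The trivalent vertex with two edges up. -/
def splitHom (i : Fin n) : obj 𝕜 [i] ⟶ obj 𝕜 [i] ⊗ obj 𝕜 [i] := mk (Diagram.split i)

/-- The crossing of distant colours. -/
def crossHom {i j : Fin n} (h : Distant i j) :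
    obj 𝕜 [i] ⊗ obj 𝕜 [j] ⟶ obj 𝕜 [j] ⊗ obj 𝕜 [i] := mk (Diagram.cross i j h)

open Diagram

/-- Concatenations of explicit lists agree by computation, so these associators and unitors are
identity pictures and are removed by `Rel.id_comp`; the translations below use the same fact. -/
theorem zigzag_left_hom (i : Fin n) :
    cupHom 𝕜 i ▷ obj 𝕜 [i] ≫ (α_ _ _ _).hom ≫ obj 𝕜 [i] ◁ capHom 𝕜 i =
      (λ_ _).hom ≫ (ρ_ _).inv :=
  mk_sound (((Rel.refl _).comp_congr (Rel.id_comp _)).trans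
    ((Rel.of (.zigzag_left i)).trans (Rel.id_comp _).symm))

theorem zigzag_right_hom (i : Fin n) :
    obj 𝕜 [i] ◁ cupHom 𝕜 i ≫ (α_ _ _ _).inv ≫ capHom 𝕜 i ▷ obj 𝕜 [i] =
      (ρ_ _).hom ≫ (λ_ _).inv :=
  mk_sound (((Rel.refl _).comp_congr (Rel.id_comp _)).trans
    ((Rel.of (.zigzag_right i)).trans (Rel.id_comp _).symm))

theorem rotate_dot_left_hom (i : Fin n) :
    startdotHom 𝕜 i ▷ obj 𝕜 [i] ≫ capHom 𝕜 i = (λ_ _).hom ≫ enddotHom 𝕜 i :=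
  mk_sound ((Rel.of (.rotate_dot_left i)).trans (Rel.id_comp _).symm)

theorem rotate_dot_right_hom (i : Fin n) :
    obj 𝕜 [i] ◁ startdotHom 𝕜 i ≫ capHom 𝕜 i = (ρ_ _).hom ≫ enddotHom 𝕜 i :=
  mk_sound ((Rel.of (.rotate_dot_right i)).trans (Rel.id_comp _).symm)

theorem rotate_merge_left_hom (i : Fin n) :
    cupHom 𝕜 i ▷ obj 𝕜 [i] ≫ (α_ _ _ _).hom ≫ obj 𝕜 [i] ◁ mergeHom 𝕜 i =
      (λ_ _).hom ≫ splitHom 𝕜 i :=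
  mk_sound (((Rel.refl _).comp_congr (Rel.id_comp _)).trans
    ((Rel.of (.rotate_merge_left i)).trans (Rel.id_comp _).symm))

theorem rotate_cross_right_hom {i j : Fin n} (h : Distant i j) :
    (obj 𝕜 [j] ⊗ obj 𝕜 [i]) ◁ cupHom 𝕜 j ≫ (α_ _ _ _).hom ≫ obj 𝕜 [j] ◁ (α_ _ _ _).inv ≫
      obj 𝕜 [j] ◁ crossHom 𝕜 h ▷ obj 𝕜 [j] ≫ obj 𝕜 [j] ◁ (α_ _ _ _).hom ≫ (α_ _ _ _).inv ≫
        capHom 𝕜 j ▷ (obj 𝕜 [i] ⊗ obj 𝕜 [j]) =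
      (ρ_ (obj 𝕜 [j] ⊗ obj 𝕜 [i])).hom ≫ crossHom 𝕜 h.symm ≫
        (λ_ (obj 𝕜 [i] ⊗ obj 𝕜 [j])).inv := by
  refine mk_sound (Rel.trans ?_ ((Rel.of (.rotate_cross_right i j h)).trans
    ((Rel.id_comp _).trans (Rel.comp_id _)).symm))
  refine (Rel.refl _).comp_congr ((Rel.id_comp _).trans ?_)
  refine (((Rel.id_tens_id [j] [i, j, j]).comp_congr (Rel.refl _)).trans (Rel.id_comp _)).trans ?_
  refine (Rel.refl _).comp_congr ?_
  exact (((Rel.id_tens_id [j] [j, i, j]).comp_congr (Rel.refl _)).trans (Rel.id_comp _)).trans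
    (Rel.id_comp _)

theorem cross_cross_hom {i j : Fin n} (h : Distant i j) :
    crossHom 𝕜 h ≫ crossHom 𝕜 h.symm = 𝟙 _ :=
  mk_sound (Rel.of (.cross_cross i j h))

theorem slide_dot_hom {i j : Fin n} (h : Distant i j) :
    startdotHom 𝕜 i ▷ obj 𝕜 [j] ≫ crossHom 𝕜 h =
      (λ_ _).hom ≫ (ρ_ _).inv ≫ obj 𝕜 [j] ◁ startdotHom 𝕜 i :=
  mk_sound ((Rel.of (.slide_dot i j h)).trans ((Rel.id_comp _).trans (Rel.id_comp _)).symm)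

theorem unit_hom (i : Fin n) :
    startdotHom 𝕜 i ▷ obj 𝕜 [i] ≫ mergeHom 𝕜 i = (λ_ _).hom :=
  mk_sound (Rel.of (.unit_one i))

theorem needle_hom (i : Fin n) : splitHom 𝕜 i ≫ capHom 𝕜 i = 0 :=
  mk_sound (Rel.of (.needle i))

theorem mk_ddot_tens_id (i j : Fin n) :
    mk (𝕜 := 𝕜) (Diagram.tens (ddot j) (Diagram.id [i])) =
      leftScalar (startdotHom 𝕜 j ≫ enddotHom 𝕜 j) (obj 𝕜 [i]) :=
  mk_sound ((Rel.id_comp _).trans (Rel.comp_id _)).symm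

theorem mk_id_tens_ddot (i j : Fin n) :
    mk (𝕜 := 𝕜) (Diagram.tens (Diagram.id [i]) (ddot j)) =
      rightScalar (startdotHom 𝕜 j ≫ enddotHom 𝕜 j) (obj 𝕜 [i]) :=
  mk_sound ((Rel.id_comp _).trans (Rel.comp_id _)).symm

theorem force_same_hom (i : Fin n) :
    leftScalar (startdotHom 𝕜 i ≫ enddotHom 𝕜 i) (obj 𝕜 [i]) +
        rightScalar (startdotHom 𝕜 i ≫ enddotHom 𝕜 i) (obj 𝕜 [i]) =
      enddotHom 𝕜 i ≫ startdotHom 𝕜 i + enddotHom 𝕜 i ≫ startdotHom 𝕜 i := by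
  rw [← two_smul 𝕜 (enddotHom 𝕜 i ≫ startdotHom 𝕜 i), ← mk_ddot_tens_id, ← mk_id_tens_ddot]
  exact mk_sound (Rel.of (.force_same i))

theorem force_adjacent_hom {i j : Fin n} (h : Adjacent i j) :
    leftScalar (startdotHom 𝕜 j ≫ enddotHom 𝕜 j) (obj 𝕜 [i]) + enddotHom 𝕜 i ≫ startdotHom 𝕜 i =
      rightScalar (startdotHom 𝕜 j ≫ enddotHom 𝕜 j) (obj 𝕜 [i]) +
        rightScalar (startdotHom 𝕜 i ≫ enddotHom 𝕜 i) (obj 𝕜 [i]) := by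
  rw [← mk_ddot_tens_id, ← mk_id_tens_ddot, ← mk_id_tens_ddot]
  exact mk_sound (Rel.of (.force_adjacent i j h))

theorem switch_hom {i j : Fin n} (h : Adjacent i j) :
    enddotHom 𝕜 i ▷ obj 𝕜 [j] ≫ (λ_ _).hom ≫ (ρ_ _).inv ≫ obj 𝕜 [j] ◁ startdotHom 𝕜 i +
      obj 𝕜 [i] ◁ enddotHom 𝕜 j ≫ (ρ_ _).hom ≫ (λ_ _).inv ≫ startdotHom 𝕜 j ▷ obj 𝕜 [i] = 0 := by
  refine mk_sound (Rel.trans (Rel.add_congr ?_ ?_) (Rel.of (.switch i j h)))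
  · refine ((Rel.refl _).comp_congr ((Rel.id_comp _).trans (Rel.id_comp _))).trans ?_
    -- An empty strand on the left lets interchange bring both dots to the same height.
    refine ((Rel.refl _).comp_congr (Rel.id_nil_tens _).symm).trans ?_
    exact (Rel.interchange (enddot i) (Diagram.id []) (Diagram.id [j])
      (Diagram.tens (Diagram.id [j]) (startdot i))).trans
        ((Rel.comp_id _).tens_congr (Rel.id_comp _))
  · refine ((Rel.refl _).comp_congr ((Rel.id_comp _).trans (Rel.id_comp _))).trans ?_
    refine ((Rel.id_nil_tens _).symm.comp_congr (Rel.refl _)).trans ?_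
    exact (Rel.interchange (Diagram.id []) (startdot j)
      (Diagram.tens (Diagram.id [i]) (enddot j)) (Diagram.id [i])).trans
        ((Rel.id_comp _).tens_congr (Rel.comp_id _))

end Generators

/-! ## The linear forms annihilating two dots -/

section Annihilation

variable (𝕜 : Type u) [Field 𝕜] {n : ℕ}

theorem startdot_comp_enddot (i : Fin n) :
    startdotHom 𝕜 i ≫ enddotHom 𝕜 i = ddotEnd 𝕜 i := rfl

theorem cup_enddot_right (i : Fin n) :
    cupHom 𝕜 i ≫ obj 𝕜 [i] ◁ enddotHom 𝕜 i ≫ (ρ_ _).hom = startdotHom 𝕜 i :=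
  cup_whiskerLeft_enddot (zigzag_left_hom 𝕜 i) (rotate_dot_right_hom 𝕜 i)

theorem split_enddot_left (i : Fin n) :
    splitHom 𝕜 i ≫ enddotHom 𝕜 i ▷ obj 𝕜 [i] ≫ (λ_ _).hom = 𝟙 _ :=
  split_whiskerRight_enddot
    (cup_whiskerRight_enddot (zigzag_right_hom 𝕜 i) (rotate_dot_left_hom 𝕜 i))
    (rotate_merge_left_hom 𝕜 i) (unit_hom 𝕜 i)

theorem leftScalar_ddot_of_distant {i j : Fin n} (h : Distant i j) :
    leftScalar (ddotEnd 𝕜 j) (obj 𝕜 [i]) = rightScalar (ddotEnd 𝕜 j) (obj 𝕜 [i]) :=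
  leftScalar_eq_rightScalar_of_cross (slide_dot_hom 𝕜 h.symm)
    (cross_whiskerLeft_enddot (cup_enddot_right 𝕜 j) (rotate_dot_right_hom 𝕜 j)
      (rotate_cross_right_hom 𝕜 h) (slide_dot_hom 𝕜 h.symm) (cross_cross_hom 𝕜 h.symm))

/-- The part `2 f_{i+1} + ⋯ + 2 f_{j-1} + f_j` of `y_{i,j} / (f_i f_j)`, as a picture. -/
noncomputable def tailEnd (i j : Fin n) : End (𝟙_ (TLC₁ 𝕜 n)) :=
  ∑ l ∈ Finset.Ioo i j, 2 * ddotEnd 𝕜 l + ddotEnd 𝕜 j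

theorem tailEnd_of_covBy {i j : Fin n} (h : (i : ℕ) + 1 = j) : tailEnd 𝕜 i j = ddotEnd 𝕜 j := by
  have : Finset.Ioo i j = ∅ := by
    ext l
    simp only [Finset.mem_Ioo, Fin.lt_def, Finset.notMem_empty, iff_false]
    omega
  simp [tailEnd, this]

/-- The coefficient 2 is kept as two copies of f_k, the inner bracket being the form of k, j; this
matches the shape produced by `rightScalar_force`. -/
theorem tailEnd_step {i k j : Fin n} (hik : (i : ℕ) + 1 = k) (hkj : k < j) :
    tailEnd 𝕜 i j = ddotEnd 𝕜 k + (ddotEnd 𝕜 k + tailEnd 𝕜 k j) := by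
  have : Finset.Ioo i j = insert k (Finset.Ioo k j) := by
    ext l
    simp only [Finset.mem_Ioo, Finset.mem_insert, Fin.lt_def, Fin.ext_iff] at hkj ⊢
    omega
  rw [tailEnd, this, Finset.sum_insert (by simp), tailEnd, two_mul]
  abel

/-- All colours of the tail exceed k, hence are distant from i. -/
theorem leftScalar_tailEnd {i k j : Fin n} (hik : (i : ℕ) + 1 = k) (hkj : k < j) :
    leftScalar (tailEnd 𝕜 k j) (obj 𝕜 [i]) = rightScalar (tailEnd 𝕜 k j) (obj 𝕜 [i]) := by
  have hadd (g h : End (𝟙_ (TLC₁ 𝕜 n)))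
      (hg : leftScalar g (obj 𝕜 [i]) = rightScalar g (obj 𝕜 [i]))
      (hh : leftScalar h (obj 𝕜 [i]) = rightScalar h (obj 𝕜 [i])) :
      leftScalar (g + h) (obj 𝕜 [i]) = rightScalar (g + h) (obj 𝕜 [i]) :=
    (leftScalar_add g h _).trans ((congrArg₂ (· + ·) hg hh).trans (rightScalar_add g h _).symm)
  refine hadd _ _ ?_ (leftScalar_ddot_of_distant 𝕜 ?_)
  · refine Finset.sum_induction _
      (fun g : End (𝟙_ (TLC₁ 𝕜 n)) => leftScalar g (obj 𝕜 [i]) = rightScalar g (obj 𝕜 [i]))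
      hadd ?_ fun l hl => ?_
    · exact (by simp [leftScalar, rightScalar] :
        leftScalar (0 : 𝟙_ (TLC₁ 𝕜 n) ⟶ 𝟙_ _) (obj 𝕜 [i]) = rightScalar 0 (obj 𝕜 [i]))
    · have h : Distant i l := by
        simp only [Finset.mem_Ioo, Fin.lt_def] at hl
        left; omega
      rw [two_mul]
      exact hadd _ _ (leftScalar_ddot_of_distant 𝕜 h) (leftScalar_ddot_of_distant 𝕜 h)
  · left
    simp only [Fin.lt_def] at hkj
    omega

/-- The linear form `f_i + 2 f_{i+1} + ⋯ + 2 f_{j-1} + f_j` as a picture. -/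
noncomputable def formEnd (i j : Fin n) : End (𝟙_ (TLC₁ 𝕜 n)) :=
  ddotEnd 𝕜 i + tailEnd 𝕜 i j

/-- Two dots side by side. -/
def twoDots (i j : Fin n) : 𝟙_ (TLC₁ 𝕜 n) ⟶ obj 𝕜 [i] ⊗ obj 𝕜 [j] :=
  (λ_ _).inv ≫ (startdotHom 𝕜 i ⊗ₘ startdotHom 𝕜 j)

/-- Closing the i-dot of the pair makes it a double dot. -/
theorem ddotEnd_mul_comp_startdot_left {w : End (𝟙_ (TLC₁ 𝕜 n))} {i j : Fin n}
    (h : w ≫ twoDots 𝕜 i j = 0) : (ddotEnd 𝕜 i * w : End _) ≫ startdotHom 𝕜 j = 0 := by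
  rw [End.mul_def, Category.assoc, ← startdot_comp_enddot,
    ← startdot_tensor_startdot_enddot_left]
  rw [twoDots] at h
  rw [reassoc_of% h, Limits.zero_comp]

theorem ddotEnd_mul_comp_startdot_right {w : End (𝟙_ (TLC₁ 𝕜 n))} {i j : Fin n}
    (h : w ≫ twoDots 𝕜 i j = 0) : (ddotEnd 𝕜 j * w : End _) ≫ startdotHom 𝕜 i = 0 := by
  rw [End.mul_def, Category.assoc, ← startdot_comp_enddot,
    ← startdot_tensor_startdot_enddot_right]
  rw [twoDots] at h
  rw [reassoc_of% h, Limits.zero_comp]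

theorem twoDots_of_adjacent {i j : Fin n} (h : Adjacent i j) :
    (ddotEnd 𝕜 i + ddotEnd 𝕜 j) ≫ twoDots 𝕜 j i = 0 :=
  startdot_tensor_startdot_of_switch (switch_hom 𝕜 h)

theorem formEnd_twoDots_step {i k j : Fin n} (hik : (i : ℕ) + 1 = k) (hkj : k < j)
    (h : formEnd 𝕜 k j ≫ twoDots 𝕜 k j = 0) : formEnd 𝕜 i j ≫ twoDots 𝕜 i j = 0 := by
  have hij : Distant i j := by
    simp only [Fin.lt_def] at hkj
    left; omega
  have hforce := rightScalar_force (force_same_hom 𝕜 i) (force_adjacent_hom 𝕜 (Or.inl hik))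
    (leftScalar_tailEnd 𝕜 hik hkj)
  have hneedle := split_rightScalar_cap (split_enddot_left 𝕜 i) (rotate_dot_left_hom 𝕜 i)
    (needle_hom 𝕜 i) hforce
  have hg : (ddotEnd 𝕜 k ≫ formEnd 𝕜 k j) ≫ startdotHom 𝕜 j = 0 := by
    -- The product in `End` is composition in the opposite order.
    rw [← End.mul_def, mul_comm]
    exact ddotEnd_mul_comp_startdot_left 𝕜 h
  have := startdot_tensor_startdot_of_needle (cup_enddot_right 𝕜 i) (slide_dot_hom 𝕜 hij.symm)
    hneedle hg
  rw [formEnd, tailEnd_step 𝕜 hik hkj, ← add_assoc]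
  exact this

theorem formEnd_twoDots {i j : Fin n} (hij : i < j) : formEnd 𝕜 i j ≫ twoDots 𝕜 i j = 0 := by
  -- Here d counts the indices strictly between i and j. The induction fixes j and varies i, as the
  -- step adds a colour at the left end.
  obtain ⟨d, hd⟩ : ∃ d, (i : ℕ) + 1 + d = j := Nat.exists_eq_add_of_le hij |>.imp fun _ h => h.symm
  induction d generalizing i with
  | zero =>
    rw [formEnd, tailEnd_of_covBy 𝕜 hd, add_comm]
    exact twoDots_of_adjacent 𝕜 (Or.inr hd)
  | succ d ih =>
    have hk : (i : ℕ) + 1 < n := by omega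
    have hkj : (⟨i + 1, hk⟩ : Fin n) < j := by
      rw [Fin.lt_def]
      change (i : ℕ) + 1 < j
      omega
    refine formEnd_twoDots_step 𝕜 (k := ⟨i + 1, hk⟩) rfl hkj (ih hkj ?_)
    change (i : ℕ) + 1 + 1 + d = j
    omega

/-- A sequence may list j before i. Distant dots are exchanged by a crossing; for adjacent colours
the switch relation gives both orders. -/
theorem formEnd_twoDots_swap {i j : Fin n} (hij : i < j) :
    formEnd 𝕜 i j ≫ twoDots 𝕜 j i = 0 := by
  rcases Nat.lt_or_eq_of_le (Nat.succ_le_of_lt (Fin.lt_def.1 hij)) with h | h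
  · have hc := startdot_tensor_startdot_cross (s' := startdotHom 𝕜 j)
      (slide_dot_hom 𝕜 (Or.inl h : Distant i j))
    rw [twoDots, ← hc]
    have := formEnd_twoDots 𝕜 hij
    rw [twoDots] at this
    rw [reassoc_of% this, Limits.zero_comp]
  · rw [formEnd, tailEnd_of_covBy 𝕜 h]
    exact twoDots_of_adjacent 𝕜 (Or.inl h)

end Annihilation

/-! ## Factoring the picture of dots -/

section Factor

variable (𝕜 : Type u) [Field 𝕜] {n : ℕ}

theorem phi_cons (i : Fin n) (s : List (Fin n)) :
    phi 𝕜 (i :: s) = (λ_ _).inv ≫ (startdotHom 𝕜 i ⊗ₘ phi 𝕜 s) :=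
  (mk_sound (Diagram.Rel.id_comp _)).symm

/-- The new dot has no bottom boundary, so it can be raised above p and absorbed into q. -/
theorem phi_cons_factor {k : Fin n} {s : List (Fin n)} {a : TLC₁ 𝕜 n} {p : 𝟙_ _ ⟶ a}
    (h : ∃ q : a ⟶ obj 𝕜 s, phi 𝕜 s = p ≫ q) :
    ∃ q : a ⟶ obj 𝕜 (k :: s), phi 𝕜 (k :: s) = p ≫ q := by
  obtain ⟨q, hq⟩ := h
  refine ⟨(λ_ _).inv ≫ (startdotHom 𝕜 k ⊗ₘ q), (phi_cons 𝕜 k s).trans ?_⟩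
  rw [hq]
  exact tensorHom_comp_eq_comp_tensorHom _ _ _

theorem phi_factor {i : Fin n} {s : List (Fin n)} (hi : i ∈ s) :
    ∃ q : obj 𝕜 [i] ⟶ obj 𝕜 s, phi 𝕜 s = startdotHom 𝕜 i ≫ q := by
  induction s with
  | nil => simp at hi
  | cons k s ih =>
    rcases List.mem_cons.1 hi with rfl | hi
    · exact ⟨(ρ_ _).inv ≫ obj 𝕜 [i] ◁ phi 𝕜 s,
        (phi_cons 𝕜 i s).trans (tensorHom_eq_comp_whiskerLeft _ _)⟩
    · exact phi_cons_factor 𝕜 (ih hi)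

/-- Entries are stripped until the first of i, j appears; it decides the order of the pair, and the
other is found in the rest. -/
theorem phi_factor_two {i j : Fin n} (hij : i ≠ j) {s : List (Fin n)} (hi : i ∈ s) (hj : j ∈ s) :
    (∃ q : obj 𝕜 [i] ⊗ obj 𝕜 [j] ⟶ obj 𝕜 s, phi 𝕜 s = twoDots 𝕜 i j ≫ q) ∨
      ∃ q : obj 𝕜 [j] ⊗ obj 𝕜 [i] ⟶ obj 𝕜 s, phi 𝕜 s = twoDots 𝕜 j i ≫ q := by
  have hcons {k l : Fin n} {s : List (Fin n)} (hl : l ∈ s) :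
      ∃ q : obj 𝕜 [k] ⊗ obj 𝕜 [l] ⟶ obj 𝕜 (k :: s), phi 𝕜 (k :: s) = twoDots 𝕜 k l ≫ q := by
    obtain ⟨q, hq⟩ := phi_factor 𝕜 hl
    refine ⟨obj 𝕜 [k] ◁ q, (phi_cons 𝕜 k s).trans ?_⟩
    rw [hq]
    exact tensorHom_comp_eq_comp_whiskerLeft _ _ _
  induction s with
  | nil => simp at hi
  | cons k s ih =>
    rcases List.mem_cons.1 hi with rfl | hi'
    · exact Or.inl (hcons ((List.mem_cons.1 hj).resolve_left hij.symm))
    · rcases List.mem_cons.1 hj with rfl | hj'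
      · exact Or.inr (hcons hi')
      · exact (ih hi' hj').imp (phi_cons_factor 𝕜) (phi_cons_factor 𝕜)

end Factor

/-! ## Elements of the TL ideals -/

section Membership

variable {𝕜 : Type u} [Field 𝕜] {n : ℕ} (hchar : ¬ ringChar 𝕜 ∣ 2 * (n + 1))

theorem box_f (i : Fin n) : box hchar (f 𝕜 n i) = ddotEnd 𝕜 i := by
  simp [box, toF_f]

theorem box_form (i j : Fin n) :
    box hchar (f 𝕜 n i + ∑ l ∈ Finset.Ioo i j, 2 * f 𝕜 n l + f 𝕜 n j) = formEnd 𝕜 i j := by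
  simp only [map_add, map_sum, map_mul, map_ofNat, box_f, formEnd, tailEnd, add_assoc]

theorem mem_TLIdeal {s : List (Fin n)} {r : R 𝕜 n} :
    r ∈ TLIdeal hchar s ↔ (box hchar r : 𝟙_ (TLC₁ 𝕜 n) ⟶ 𝟙_ _) ≫ phi 𝕜 s = 0 := by
  rw [← act_eq_comp]
  rfl

theorem z_mem_TLIdeal (s : List (Fin n)) {i j : Fin n} (hij : i < j) :
    z 𝕜 n s i j ∈ TLIdeal hchar s := by
  have h := formEnd_twoDots 𝕜 hij
  rw [mem_TLIdeal, z, map_mul, map_mul, box_form]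
  by_cases hi : i ∈ s <;> by_cases hj : j ∈ s <;>
    simp only [hi, hj, if_true, if_false, map_one, one_mul, mul_one, box_f]
  · rcases phi_factor_two 𝕜 hij.ne hi hj with ⟨q, hq⟩ | ⟨q, hq⟩
    · rw [hq, reassoc_of% h, Limits.zero_comp]
    · rw [hq, reassoc_of% formEnd_twoDots_swap 𝕜 hij, Limits.zero_comp]
  · obtain ⟨q, hq⟩ := phi_factor 𝕜 hi
    rw [hq, reassoc_of% ddotEnd_mul_comp_startdot_right 𝕜 h, Limits.zero_comp]
  · obtain ⟨q, hq⟩ := phi_factor 𝕜 hj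
    rw [hq, reassoc_of% ddotEnd_mul_comp_startdot_left 𝕜 h, Limits.zero_comp]
  -- With neither index in s both dots are closed, so the scalar itself vanishes.
  · have h0 : ddotEnd 𝕜 i * ddotEnd 𝕜 j * formEnd 𝕜 i j = 0 := by
      rw [mul_comm (ddotEnd 𝕜 i), mul_assoc, End.mul_def (ddotEnd 𝕜 j), ← startdot_comp_enddot 𝕜 j,
        reassoc_of% ddotEnd_mul_comp_startdot_left 𝕜 h, Limits.zero_comp]
    rw [h0]
    exact Limits.zero_comp

theorem y_mem_TLIdeal {i j : Fin n} (hij : i < j) : y 𝕜 n i j ∈ TLIdeal hchar [] := by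
  have := z_mem_TLIdeal hchar [] hij
  simpa [z, y] using this

end Membership

end TLC

theorem proposition3 {𝕜 : Type*} [Field 𝕜] (n : ℕ) (hchar : ¬ ringChar 𝕜 ∣ 2 * (n + 1)) :
    (∀ i j : Fin n, i < j → TLC.y 𝕜 n i j ∈ TLC.TLIdeal hchar []) ∧
      ∀ s : List (Fin n), s.Nodup →
        ∀ i j : Fin n, i < j → TLC.z 𝕜 n s i j ∈ TLC.TLIdeal hchar s :=
  ⟨fun _ _ hij => TLC.y_mem_TLIdeal hchar hij,
    fun s _ _ _ hij => TLC.z_mem_TLIdeal hchar s hij⟩
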